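/- **Setting.** Let $\mathbb{F}_v$ be a finite field with $q_v$ elements, $A_v=\mathbb{F}_v[\![z]\!]$ and $Q_v=\mathbb{F}_v(\!(z)\!)$. Let $R$ be a complete discrete valuation ring with finite residue field and let $\gamma\colon A_v\hookrightarrow R$ be an injective ring homomorphism such that $\zeta:=\gamma(z)$ lies in the maximal ideal of $R$. View $R$ as an $\mathbb{F}_v$-algebra via $\gamma$; then $A_v\subset R[\![z]\!]$ and $Q_v\subset R[\![z]\!][\frac1z]$ by acting on coefficients. Let $\hat\sigma$ be the endomorphism of $R[\![z]\!]$ with $\hat\sigma(z)=z$ and $\hat\sigma(b)=b^{q_v}$ for $b\in R$; it extends to $R[\![z]\!][\frac1z]$. For an $R[\![z]\!]$-module $M$ put $\hat\sigma^*M:=M\otimes_{R[\![z]\!],\hat\sigma}R[\![z]\!]$. A *local shtuka* over $R$ is a pair $\underline{\hat M}=(\hat M,\tau_{\hat M})$ consisting of a free $R[\![z]\!]$-module $\hat M$ of finite rank and an isomorphism $\tau_{\hat M}\colon\hat\sigma^*\hat M[\frac1{z-\zeta}]\to\hat M[\frac1{z-\zeta}]$ of $R[\![z]\!][\frac1{z-\zeta}]$-modules;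 its rank is the rank of $\hat M$. A *morphism* $(\hat M,\tau_{\hat M})\to(\hat N,\tau_{\hat N})$ is a homomorphism $f\colon\hat M\to\hat N$ of $R[\![z]\!]$-modules with $\tau_{\hat N}\circ\hat\sigma^*f=f\circ\tau_{\hat M}$. A *quasi-morphism* is a homomorphism $f\colon\hat M[\frac1z]\to\hat N[\frac1z]$ of $R[\![z]\!][\frac1z]$-modules with $\tau_{\hat N}\circ\hat\sigma^*f=f\circ\tau_{\hat M}$ (after inverting both $z$ and $z-\zeta$); it is a *quasi-isogeny* if it is an isomorphism. Let $\mathrm{End}_R(\underline{\hat M})$ be the $A_v$-algebra of endomorphisms and $\mathrm{QEnd}_R(\underline{\hat M})$ the $Q_v$-algebra of quasi-morphisms from $\underline{\hat M}$ to itself; $\mathrm{End}_R(\underline{\hat M})\subset\mathrm{QEnd}_R(\underline{\hat M})$ via $h\mapsto h[\frac1z]$. **Proposition 3.2.** Let $\underline{\hat M}$ be a local shtuka over $R$ with complex multiplication by $E_v$; that is, $E_v$ is a commutative semi-simple $Q_v$-algebra (a finite product of finite, not necessarily separable, field extensions of $Q_v$) with $\dim_{Q_v}E_v=\operatorname{rk}\underline{\hat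 M}$, together with an injective homomorphism of $Q_v$-algebras $\iota\colon E_v\hookrightarrow\mathrm{QEnd}_R(\underline{\hat M})$. Let $\mathcal{O}_{E_v}$ be the integral closure of $A_v$ in $E_v$. Then there are a local shtuka $\underline{\hat M}'$ over $R$ and a quasi-isogeny $f\colon\underline{\hat M}\to\underline{\hat M}'$ such that $\mathcal{O}_{E_v}\subset\mathrm{End}_R(\underline{\hat M}')$ under the induced embedding $E_v\hookrightarrow\mathrm{QEnd}_R(\underline{\hat M}')$, $a\mapsto f\,\iota(a)\,f^{-1}$. That is, there is an injective homomorphism of $A_v$-algebras $j\colon\mathcal{O}_{E_v}\hookrightarrow\mathrm{End}_R(\underline{\hat M}')$ with $j(a)[\frac1z]\circ f=f\circ\iota(a)$ for all $a\in\mathcal{O}_{E_v}$. -/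

import Mathlib

universe u v w

open scoped PowerSeries LaurentSeries TensorProduct

noncomputable section

namespace LocSht

/-! ### Pullback of a module along a ring endomorphism -/

section Pullback

variable {S : Type*} [CommRing S] (σ : S →+* S)

/-- The ring `S`, regarded as an `S`-algebra by means of the endomorphism `σ`. -/
def Twist (_σ : S →+* S) : Type _ := S

instance : CommRing (Twist σ) := inferInstanceAs (CommRing S)

instance : Algebra S (Twist σ) := RingHom.toAlgebra (S := Twist σ) σ

/-- The identity, from `S` to its twisted copy. -/
def toTwist : S ≃+* Twist σ := RingEquiv.refl S

lemma algebraMap_twist (s : S) : algebraMap S (Twist σ) s = toTwist σ (σ s) := rfl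

/-- The pullback `σ^* M = S ⊗_{σ, S} M`. -/
def Pullback (M : Type*) [AddCommGroup M] [Module S M] : Type _ := Twist σ ⊗[S] M

variable {M N Q : Type*} [AddCommGroup M] [Module S M] [AddCommGroup N] [Module S N]
  [AddCommGroup Q] [Module S Q]

instance : AddCommGroup (Pullback σ M) := inferInstanceAs (AddCommGroup (Twist σ ⊗[S] M))

instance : Module (Twist σ) (Pullback σ M) := inferInstanceAs (Module (Twist σ) (Twist σ ⊗[S] M))

/-- `S` acts on `σ^* M = S ⊗_{σ, S} M` through the left factor (with its untwisted action). -/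
instance : Module S (Pullback σ M) := Module.compHom _ (toTwist σ : S →+* Twist σ)

/-- The `σ`-semilinear map `M → σ^* M`, `m ↦ 1 ⊗ m`. -/
def pullbackMk : M →ₛₗ[σ] Pullback σ M where
  toFun m := ((1 : Twist σ) ⊗ₜ[S] m : Twist σ ⊗[S] M)
  map_add' x y := TensorProduct.tmul_add _ _ _
  map_smul' s m := by
    change ((1 : Twist σ) ⊗ₜ[S] (s • m) : Twist σ ⊗[S] M) =
      toTwist σ (σ s) • ((1 : Twist σ) ⊗ₜ[S] m : Twist σ ⊗[S] M)
    rw [← algebraMap_twist, algebraMap_smul, TensorProduct.tmul_smul]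

lemma pullback_induction {p : Pullback σ M → Prop} (h0 : p 0)
    (hs : ∀ (s : S) (m : M), p (s • pullbackMk σ m)) (ha : ∀ x y, p x → p y → p (x + y))
    (x : Pullback σ M) : p x := by
  refine TensorProduct.induction_on (motive := fun x : Twist σ ⊗[S] M => p x) x h0 ?_ ha
  intro t m
  have h := hs ((toTwist σ).symm t) m
  have e : (toTwist σ).symm t • pullbackMk σ m = (t ⊗ₜ[S] m : Twist σ ⊗[S] M) := by
    change t • ((1 : Twist σ) ⊗ₜ[S] m : Twist σ ⊗[S] M) = _
    rw [TensorProduct.smul_tmul', smul_eq_mul, mul_one]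
  rwa [e] at h

variable {σ}

lemma pullback_hom_ext {f g : Pullback σ M →ₗ[S] Q}
    (h : ∀ m, f (pullbackMk σ m) = g (pullbackMk σ m)) : f = g := by
  ext x
  induction x using pullback_induction with
  | h0 => simp
  | hs s m => simp [h]
  | ha x y hx hy => simp [hx, hy]

/-- The linear map `σ^* M → Q`, `s ⊗ m ↦ s • g m`, attached to a `σ`-semilinear map `g`. -/
def pullbackLift (g : M →ₛₗ[σ] Q) : Pullback σ M →ₗ[S] Q :=
  let F : Twist σ ⊗[S] M →+ Q := TensorProduct.liftAddHom
    { toFun := fun t =>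
        { toFun := fun m => (toTwist σ).symm t • g m
          map_zero' := by simp
          map_add' := by simp }
      map_zero' := by ext m; simp
      map_add' := fun s t => by ext m; simp [add_smul] }
    (by
      intro r t m
      change (toTwist σ).symm (r • t) • g m = (toTwist σ).symm t • g (r • m)
      rw [Algebra.smul_def, algebraMap_twist, map_mul, RingEquiv.symm_apply_apply,
        LinearMap.map_smulₛₗ, mul_comm, mul_smul])
  { toFun := F
    map_add' := F.map_add
    map_smul' := by
      intro s x
      refine TensorProduct.induction_on (motive := fun x : Twist σ ⊗[S] M =>
        F (toTwist σ s • x) = s • F x) x (by simp) ?_ ?_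
      · intro t m
        change (toTwist σ).symm (toTwist σ s * t) • g m = s • (toTwist σ).symm t • g m
        rw [map_mul, RingEquiv.symm_apply_apply, mul_smul]
      · intro x y hx hy
        rw [smul_add, F.map_add, F.map_add, hx, hy, smul_add] }

@[simp] lemma pullbackLift_mk (g : M →ₛₗ[σ] Q) (m : M) :
    pullbackLift g (pullbackMk σ m) = g m := by
  change (toTwist σ).symm 1 • g m = g m
  rw [map_one, one_smul]

variable (σ) in
/-- The pullback `σ^* f : σ^* M → σ^* N`, `s ⊗ m ↦ s ⊗ f m`, of a linear map `f : M → N`. -/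
def pullbackMap (f : M →ₗ[S] N) : Pullback σ M →ₗ[S] Pullback σ N :=
  pullbackLift ((pullbackMk σ).comp f)

@[simp] lemma pullbackMap_mk (f : M →ₗ[S] N) (m : M) :
    pullbackMap σ f (pullbackMk σ m) = pullbackMk σ (f m) := by
  simp [pullbackMap]

end Pullback

/-! ### Extension of scalars between `S`-algebras -/

section ExtendScalars

variable {S P B : Type*} [CommRing S] [CommRing P] [CommRing B] [Algebra S P] [Algebra S B]
  {M N N' : Type*} [AddCommGroup M] [Module S M] [AddCommGroup N] [Module S N]
  [AddCommGroup N'] [Module S N']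

/-- The `B`-linear map `B ⊗ M → B ⊗ N` obtained from a `P`-linear map `P ⊗ M → P ⊗ N` by extension
of scalars along a homomorphism `P → B` of `S`-algebras. -/
def extendScalars (φ : P →ₐ[S] B) (g : P ⊗[S] M →ₗ[P] P ⊗[S] N) : B ⊗[S] M →ₗ[B] B ⊗[S] N :=
  ((φ.toLinearMap.rTensor N).comp
    ((g.restrictScalars S).comp (TensorProduct.mk S P M 1))).liftBaseChange B

lemma rTensor_smul (φ : P →ₐ[S] B) (p : P) (x : P ⊗[S] N) :
    φ.toLinearMap.rTensor N (p • x) = φ p • φ.toLinearMap.rTensor N x := by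
  induction x with
  | zero => simp
  | tmul a n => simp [TensorProduct.smul_tmul']
  | add x y hx hy => simp only [smul_add, map_add, hx, hy]

lemma extendScalars_rTensor (φ : P →ₐ[S] B) (g : P ⊗[S] M →ₗ[P] P ⊗[S] N) (x : P ⊗[S] M) :
    extendScalars φ g (φ.toLinearMap.rTensor M x) = φ.toLinearMap.rTensor N (g x) := by
  induction x with
  | zero => simp
  | tmul a m =>
    have : a ⊗ₜ[S] m = a • ((1 : P) ⊗ₜ[S] m) := by simp [TensorProduct.smul_tmul']
    conv_rhs => rw [this, map_smul, rTensor_smul]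
    simp [extendScalars]
  | add x y hx hy => simp only [map_add, hx, hy]

lemma extendScalars_one_tmul (φ : P →ₐ[S] B) (g : P ⊗[S] M →ₗ[P] P ⊗[S] N) (m : M) :
    extendScalars φ g (1 ⊗ₜ m) = φ.toLinearMap.rTensor N (g (1 ⊗ₜ m)) := by
  simp [extendScalars]

lemma extendScalars_comp (φ : P →ₐ[S] B) (h : P ⊗[S] N →ₗ[P] P ⊗[S] N')
    (g : P ⊗[S] M →ₗ[P] P ⊗[S] N) :
    extendScalars φ (h ∘ₗ g) = extendScalars φ h ∘ₗ extendScalars φ g := by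
  ext m
  simp [extendScalars_one_tmul, extendScalars_rTensor]

lemma extendScalars_add (φ : P →ₐ[S] B) (g h : P ⊗[S] M →ₗ[P] P ⊗[S] N) :
    extendScalars φ (g + h) = extendScalars φ g + extendScalars φ h := by
  ext m
  simp [extendScalars_one_tmul]

lemma extendScalars_smul_id (φ : P →ₐ[S] B) (p : P) :
    extendScalars φ (p • (LinearMap.id : P ⊗[S] M →ₗ[P] P ⊗[S] M)) = φ p • LinearMap.id := by
  ext m
  simp [extendScalars_one_tmul, rTensor_smul]

end ExtendScalars

/-! ### Power series and Laurent series -/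

section Series

/-- The ring homomorphism `R((z)) → R'((z))` applying `f : R → R'` to the coefficients, obtained
from `R⟦z⟧ → R'⟦z⟧` by inverting `z`. -/
def laurentMap {R R' : Type*} [CommRing R] [CommRing R'] (f : R →+* R') : R⸨X⸩ →+* R'⸨X⸩ :=
  IsLocalization.map (M := Submonoid.powers (PowerSeries.X : R⟦X⟧))
    (T := Submonoid.powers (PowerSeries.X : R'⟦X⟧)) R'⸨X⸩ (PowerSeries.map f)
    (by rw [Submonoid.powers_le]; exact ⟨1, by simp⟩)

lemma laurentMap_algebraMap {R R' : Type*} [CommRing R] [CommRing R'] (f : R →+* R') (x : R⟦X⟧) :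
    laurentMap f (algebraMap R⟦X⟧ R⸨X⸩ x) = algebraMap R'⟦X⟧ R'⸨X⸩ (PowerSeries.map f x) :=
  IsLocalization.map_eq _ x

variable (Fv R : Type*) [Field Fv] [Fintype Fv] [CommRing R] [Algebra Fv R]

/-- The `q_v`-Frobenius `b ↦ b ^ q_v` of `R`, where `q_v` is the cardinality of `Fv`. -/
abbrev frob : R →+* R := (FiniteField.frobeniusAlgHom Fv R : R →+* R)

/-- The endomorphism `σ̂` of `R⟦z⟧` with `σ̂(z) = z` and `σ̂(b) = b ^ q_v` for `b ∈ R`. -/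
def sigmaHat : R⟦X⟧ →+* R⟦X⟧ := PowerSeries.map (frob Fv R)

/-- The extension of `σ̂` to `R⟦z⟧[1/z]`. -/
def sigmaHatLaurent : R⸨X⸩ →+* R⸨X⸩ := laurentMap (frob Fv R)

/-- The inclusion `Q_v = Fv((z)) → R⟦z⟧[1/z]`. -/
def constLaurent : Fv⸨X⸩ →+* R⸨X⸩ := laurentMap (algebraMap Fv R)

/-- The inclusion `A_v = Fv⟦z⟧ → R⟦z⟧`. -/
def constPower : Fv⟦X⟧ →+* R⟦X⟧ := PowerSeries.map (algebraMap Fv R)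

lemma sigmaHat_constPower (c : Fv⟦X⟧) : sigmaHat Fv R (constPower Fv R c) = constPower Fv R c := by
  ext n
  simp [sigmaHat, constPower]

lemma sigmaHatLaurent_constLaurent (c : Fv⸨X⸩) :
    sigmaHatLaurent Fv R (constLaurent Fv R c) = constLaurent Fv R c := by
  have : (sigmaHatLaurent Fv R).comp (constLaurent Fv R) = constLaurent Fv R := by
    refine IsLocalization.ringHom_ext (Submonoid.powers (PowerSeries.X : Fv⟦X⟧)) ?_
    ext1 x
    have h := sigmaHat_constPower Fv R x
    simp only [sigmaHat, constPower] at h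
    simp only [RingHom.comp_apply, sigmaHatLaurent, constLaurent, laurentMap_algebraMap, h]
  exact RingHom.congr_fun this c

variable {R}

/-- The ring `R⟦z⟧[1/(z - ζ)]`. -/
abbrev AwayZeta (ζ : R) : Type _ :=
  Localization.Away (PowerSeries.X - PowerSeries.C ζ : R⟦X⟧)

/-- The ring `R⟦z⟧[1/z][1/(z - ζ)]`. -/
abbrev AwayBoth (ζ : R) : Type _ :=
  Localization.Away (algebraMap R⟦X⟧ R⸨X⸩ (PowerSeries.X - PowerSeries.C ζ))

/-- The localization map `R⟦z⟧[1/z] → R⟦z⟧[1/z][1/(z - ζ)]`. -/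
def laurentToBoth (ζ : R) : R⸨X⸩ →ₐ[R⟦X⟧] AwayBoth ζ :=
  IsScalarTower.toAlgHom R⟦X⟧ R⸨X⸩ (AwayBoth ζ)

/-- The localization map `R⟦z⟧[1/(z - ζ)] → R⟦z⟧[1/z][1/(z - ζ)]`. -/
def zetaToBoth (ζ : R) : AwayZeta ζ →ₐ[R⟦X⟧] AwayBoth ζ :=
  Localization.awayMapₐ (Algebra.ofId R⟦X⟧ R⸨X⸩) (PowerSeries.X - PowerSeries.C ζ : R⟦X⟧)

end Series

/-! ### Pullback of maps between `z`-localized modules -/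

section PullbackLaurent

variable (Fv : Type*) {R : Type*} [Field Fv] [Fintype Fv] [CommRing R] [Algebra Fv R]
  {M N N' : Type*} [AddCommGroup M] [Module R⟦X⟧ M] [AddCommGroup N] [Module R⟦X⟧ N]
  [AddCommGroup N'] [Module R⟦X⟧ N']

/-- `σ̂` on `R⟦z⟧[1/z]` as a semilinear map of `R⟦z⟧`-modules. -/
def sigmaHatLaurentₛₗ : R⸨X⸩ →ₛₗ[sigmaHat Fv R] R⸨X⸩ where
  toFun := sigmaHatLaurent Fv R
  map_add' := map_add _
  map_smul' s p := by
    simp only [Algebra.smul_def, map_mul]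
    simp only [sigmaHatLaurent, laurentMap_algebraMap, sigmaHat]

/-- The semilinear map `N[1/z] → (σ̂^* N)[1/z]`, `p ⊗ n ↦ σ̂(p) ⊗ (1 ⊗ n)`. -/
def pullbackMkLaurent :
    R⸨X⸩ ⊗[R⟦X⟧] N →ₛₗ[sigmaHat Fv R] R⸨X⸩ ⊗[R⟦X⟧] Pullback (sigmaHat Fv R) N :=
  TensorProduct.map (sigmaHatLaurentₛₗ Fv) (pullbackMk (sigmaHat Fv R))

/-- The pullback `σ̂^* f : (σ̂^* M)[1/z] → (σ̂^* N)[1/z]` of a linear map `f : M[1/z] → N[1/z]`; it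
sends `1 ⊗ (1 ⊗ m)` to the image of `f (1 ⊗ m)` under `N[1/z] → (σ̂^* N)[1/z]`. -/
def pullbackMapLaurent (f : R⸨X⸩ ⊗[R⟦X⟧] M →ₗ[R⸨X⸩] R⸨X⸩ ⊗[R⟦X⟧] N) :
    R⸨X⸩ ⊗[R⟦X⟧] Pullback (sigmaHat Fv R) M →ₗ[R⸨X⸩]
      R⸨X⸩ ⊗[R⟦X⟧] Pullback (sigmaHat Fv R) N :=
  (pullbackLift ((pullbackMkLaurent Fv).comp
    ((f.restrictScalars R⟦X⟧).comp (TensorProduct.mk R⟦X⟧ R⸨X⸩ M 1)))).liftBaseChange R⸨X⸩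

lemma pullbackMapLaurent_one_tmul (f : R⸨X⸩ ⊗[R⟦X⟧] M →ₗ[R⸨X⸩] R⸨X⸩ ⊗[R⟦X⟧] N) (m : M) :
    pullbackMapLaurent Fv f (1 ⊗ₜ pullbackMk _ m) = pullbackMkLaurent Fv (f (1 ⊗ₜ m)) := by
  simp [pullbackMapLaurent]

lemma pullbackMkLaurent_smul (p : R⸨X⸩) (x : R⸨X⸩ ⊗[R⟦X⟧] N) :
    pullbackMkLaurent Fv (p • x) = sigmaHatLaurent Fv R p • pullbackMkLaurent Fv x := by
  induction x with
  | zero => simp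
  | tmul a n => simp [TensorProduct.smul_tmul', pullbackMkLaurent, sigmaHatLaurentₛₗ]
  | add x y hx hy => simp only [smul_add, map_add, hx, hy]

lemma pullbackMapLaurent_mk (f : R⸨X⸩ ⊗[R⟦X⟧] M →ₗ[R⸨X⸩] R⸨X⸩ ⊗[R⟦X⟧] N)
    (x : R⸨X⸩ ⊗[R⟦X⟧] M) :
    pullbackMapLaurent Fv f (pullbackMkLaurent Fv x) = pullbackMkLaurent Fv (f x) := by
  induction x with
  | zero => simp
  | tmul a m =>
    have : a ⊗ₜ[R⟦X⟧] m = a • ((1 : R⸨X⸩) ⊗ₜ[R⟦X⟧] m) := by simp [TensorProduct.smul_tmul']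
    have h1 : pullbackMkLaurent Fv ((1 : R⸨X⸩) ⊗ₜ[R⟦X⟧] m) = 1 ⊗ₜ pullbackMk _ m := by
      simp [pullbackMkLaurent, sigmaHatLaurentₛₗ]
    rw [this, pullbackMkLaurent_smul, map_smul, map_smul, pullbackMkLaurent_smul, h1,
      pullbackMapLaurent_one_tmul]
  | add x y hx hy => simp only [map_add, hx, hy]

lemma laurent_hom_ext {Q : Type*} [AddCommGroup Q] [Module R⟦X⟧ Q] [Module R⸨X⸩ Q]
    [IsScalarTower R⟦X⟧ R⸨X⸩ Q]
    {f g : R⸨X⸩ ⊗[R⟦X⟧] Pullback (sigmaHat Fv R) M →ₗ[R⸨X⸩] Q}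
    (h : ∀ m, f (1 ⊗ₜ pullbackMk _ m) = g (1 ⊗ₜ pullbackMk _ m)) : f = g := by
  refine TensorProduct.AlgebraTensorModule.curry_injective (LinearMap.ext_ring ?_)
  exact pullback_hom_ext h

lemma pullbackMapLaurent_comp (g : R⸨X⸩ ⊗[R⟦X⟧] N →ₗ[R⸨X⸩] R⸨X⸩ ⊗[R⟦X⟧] N')
    (f : R⸨X⸩ ⊗[R⟦X⟧] M →ₗ[R⸨X⸩] R⸨X⸩ ⊗[R⟦X⟧] N) :
    pullbackMapLaurent Fv (g ∘ₗ f) = pullbackMapLaurent Fv g ∘ₗ pullbackMapLaurent Fv f := by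
  refine laurent_hom_ext Fv fun m => ?_
  simp [pullbackMapLaurent_one_tmul, pullbackMapLaurent_mk]

lemma pullbackMapLaurent_add (f g : R⸨X⸩ ⊗[R⟦X⟧] M →ₗ[R⸨X⸩] R⸨X⸩ ⊗[R⟦X⟧] N) :
    pullbackMapLaurent Fv (f + g) = pullbackMapLaurent Fv f + pullbackMapLaurent Fv g := by
  refine laurent_hom_ext Fv fun m => ?_
  simp [pullbackMapLaurent_one_tmul]

lemma pullbackMapLaurent_smul_id (p : R⸨X⸩) :
    pullbackMapLaurent Fv (p • (LinearMap.id : R⸨X⸩ ⊗[R⟦X⟧] M →ₗ[R⸨X⸩] R⸨X⸩ ⊗[R⟦X⟧] M)) =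
      sigmaHatLaurent Fv R p • LinearMap.id := by
  refine laurent_hom_ext Fv fun m => ?_
  rw [pullbackMapLaurent_one_tmul, LinearMap.smul_apply, pullbackMkLaurent_smul]
  simp [pullbackMkLaurent, sigmaHatLaurentₛₗ]

end PullbackLaurent

end LocSht

/-! ### Local shtukas -/

open LocSht

/-- A local `σ̂`-shtuka over `R`: a finite free `R⟦z⟧`-module `M` together with an isomorphism
`τ : (σ̂^* M)[1/(z - ζ)] ≃ M[1/(z - ζ)]`. -/
structure LocalShtuka (Fv : Type u) {R : Type v} [Field Fv] [Fintype Fv] [CommRing R]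
    [Algebra Fv R] (ζ : R) where
  /-- the underlying module -/
  carrier : Type w
  [addCommGroup : AddCommGroup carrier]
  [module : Module R⟦X⟧ carrier]
  [free : Module.Free R⟦X⟧ carrier]
  [finite : Module.Finite R⟦X⟧ carrier]
  /-- the isomorphism `τ` -/
  τ : AwayZeta ζ ⊗[R⟦X⟧] Pullback (sigmaHat Fv R) carrier ≃ₗ[AwayZeta ζ]
    AwayZeta ζ ⊗[R⟦X⟧] carrier

namespace LocalShtuka

attribute [instance] addCommGroup module free finite

variable {Fv R : Type*} [Field Fv] [Fintype Fv] [CommRing R] [Algebra Fv R] {ζ : R}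

/-- The rank of a local shtuka. -/
def rank (M : LocalShtuka Fv ζ) : ℕ := Module.finrank R⟦X⟧ M.carrier

/-- The module `M[1/z]`. -/
abbrev Laurent (M : LocalShtuka Fv ζ) : Type _ := R⸨X⸩ ⊗[R⟦X⟧] M.carrier

/-- `f : M → N` is a morphism of local shtukas: `τ_N ∘ σ̂^* f = f ∘ τ_M`. -/
def IsMorphism (M N : LocalShtuka Fv ζ) (f : M.carrier →ₗ[R⟦X⟧] N.carrier) : Prop :=
  (N.τ : _ →ₗ[AwayZeta ζ] _) ∘ₗ (pullbackMap (sigmaHat Fv R) f).baseChange (AwayZeta ζ) =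
    f.baseChange (AwayZeta ζ) ∘ₗ (M.τ : _ →ₗ[AwayZeta ζ] _)

/-- `f : M[1/z] → N[1/z]` is a quasi-morphism of local shtukas: `τ_N ∘ σ̂^* f = f ∘ τ_M`, as maps
`(σ̂^* M)[1/z][1/(z - ζ)] → N[1/z][1/(z - ζ)]`. -/
def IsQuasiMorphism (M N : LocalShtuka Fv ζ) (f : M.Laurent →ₗ[R⸨X⸩] N.Laurent) : Prop :=
  extendScalars (zetaToBoth ζ) (N.τ : _ →ₗ[AwayZeta ζ] _) ∘ₗ
      extendScalars (laurentToBoth ζ) (pullbackMapLaurent Fv f) =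
    extendScalars (laurentToBoth ζ) f ∘ₗ
      extendScalars (zetaToBoth ζ) (M.τ : _ →ₗ[AwayZeta ζ] _)

/-- A quasi-isogeny from `M` to `N`: an isomorphism `M[1/z] ≃ N[1/z]` that is a quasi-morphism. -/
structure QuasiIsogeny (M N : LocalShtuka Fv ζ) where
  /-- the underlying isomorphism -/
  toLinearEquiv : M.Laurent ≃ₗ[R⸨X⸩] N.Laurent
  isQuasiMorphism : IsQuasiMorphism M N toLinearEquiv

lemma isMorphism_smul_id (M : LocalShtuka Fv ζ) {s : R⟦X⟧} (hs : sigmaHat Fv R s = s) :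
    IsMorphism M M (s • LinearMap.id) := by
  have h : pullbackMap (sigmaHat Fv R) (s • (LinearMap.id : M.carrier →ₗ[R⟦X⟧] M.carrier)) =
      s • LinearMap.id := by
    refine pullback_hom_ext fun m => ?_
    simp [LinearMap.map_smulₛₗ, hs]
  unfold IsMorphism
  rw [h]
  simp only [LinearMap.baseChange_smul, LinearMap.baseChange_id]
  ext m
  exact LinearMap.map_smul_of_tower M.τ.toLinearMap s (1 ⊗ₜ[R⟦X⟧] m)

lemma isQuasiMorphism_smul_id (M : LocalShtuka Fv ζ) {p : R⸨X⸩}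
    (hp : sigmaHatLaurent Fv R p = p) : IsQuasiMorphism M M (p • LinearMap.id) := by
  unfold IsQuasiMorphism
  rw [pullbackMapLaurent_smul_id, hp, extendScalars_smul_id, extendScalars_smul_id]
  ext m
  simp

/-- The ring `End_R(M)` of endomorphisms of a local shtuka. -/
def End (M : LocalShtuka Fv ζ) : Subring (Module.End R⟦X⟧ M.carrier) where
  carrier := {f | IsMorphism M M f}
  one_mem' := by
    have := isMorphism_smul_id M (s := 1) (by simp)
    rwa [one_smul] at this
  zero_mem' := by
    have := isMorphism_smul_id M (s := 0) (by simp)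
    rwa [zero_smul] at this
  mul_mem' := by
    intro f g hf hg
    simp only [Set.mem_ofPred_eq, IsMorphism] at hf hg ⊢
    have h : pullbackMap (sigmaHat Fv R) (f * g) =
        pullbackMap (sigmaHat Fv R) f ∘ₗ pullbackMap (sigmaHat Fv R) g :=
      pullback_hom_ext fun m => by simp
    rw [h, LinearMap.baseChange_comp, ← LinearMap.comp_assoc, hf, LinearMap.comp_assoc, hg,
      Module.End.mul_eq_comp, LinearMap.baseChange_comp, LinearMap.comp_assoc]
  add_mem' := by
    intro f g hf hg
    simp only [Set.mem_ofPred_eq, IsMorphism] at hf hg ⊢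
    have h : pullbackMap (sigmaHat Fv R) (f + g) =
        pullbackMap (sigmaHat Fv R) f + pullbackMap (sigmaHat Fv R) g :=
      pullback_hom_ext fun m => by simp
    rw [h, LinearMap.baseChange_add, LinearMap.comp_add, hf, hg, LinearMap.baseChange_add,
      LinearMap.add_comp]
  neg_mem' := by
    intro f hf
    simp only [Set.mem_ofPred_eq, IsMorphism] at hf ⊢
    have h : pullbackMap (sigmaHat Fv R) (-f) = -pullbackMap (sigmaHat Fv R) f :=
      pullback_hom_ext fun m => by simp
    rw [h, LinearMap.baseChange_neg, LinearMap.comp_neg, hf, LinearMap.baseChange_neg,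
      LinearMap.neg_comp]

/-- The `A_v`-algebra structure of `End_R(M)`, by scalar multiplication. -/
instance (M : LocalShtuka Fv ζ) : Algebra Fv⟦X⟧ M.End :=
  RingHom.toAlgebra'
    (((algebraMap R⟦X⟧ (Module.End R⟦X⟧ M.carrier)).comp (constPower Fv R)).codRestrict M.End
      fun c => isMorphism_smul_id M (sigmaHat_constPower Fv R c))
    fun c f => Subtype.ext (Algebra.commutes (constPower Fv R c) f.1)

/-- The ring `QEnd_R(M)` of quasi-endomorphisms of a local shtuka. -/
def QEnd (M : LocalShtuka Fv ζ) : Subring (Module.End R⸨X⸩ M.Laurent) where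
  carrier := {f | IsQuasiMorphism M M f}
  one_mem' := by
    have := isQuasiMorphism_smul_id M (p := 1) (by simp)
    rwa [one_smul] at this
  zero_mem' := by
    have := isQuasiMorphism_smul_id M (p := 0) (by simp)
    rwa [zero_smul] at this
  mul_mem' := by
    intro f g hf hg
    simp only [Set.mem_ofPred_eq, IsQuasiMorphism] at hf hg ⊢
    rw [Module.End.mul_eq_comp, pullbackMapLaurent_comp, extendScalars_comp, ← LinearMap.comp_assoc,
      hf, LinearMap.comp_assoc, hg, extendScalars_comp, LinearMap.comp_assoc]
  add_mem' := by
    intro f g hf hg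
    simp only [Set.mem_ofPred_eq, IsQuasiMorphism] at hf hg ⊢
    rw [pullbackMapLaurent_add, extendScalars_add, LinearMap.comp_add, hf, hg, extendScalars_add,
      LinearMap.add_comp]
  neg_mem' := by
    intro f hf
    have h := isQuasiMorphism_smul_id M (p := -1) (by simp)
    simp only [Set.mem_ofPred_eq, IsQuasiMorphism] at hf h ⊢
    have e : -f = ((-1 : R⸨X⸩) • LinearMap.id) ∘ₗ f := by ext; simp
    rw [e, pullbackMapLaurent_comp, extendScalars_comp, ← LinearMap.comp_assoc,
      h, LinearMap.comp_assoc, hf, extendScalars_comp, LinearMap.comp_assoc]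

/-- The `Q_v`-algebra structure of `QEnd_R(M)`, by scalar multiplication. -/
instance (M : LocalShtuka Fv ζ) : Algebra Fv⸨X⸩ M.QEnd :=
  RingHom.toAlgebra'
    (((algebraMap R⸨X⸩ (Module.End R⸨X⸩ M.Laurent)).comp (constLaurent Fv R)).codRestrict M.QEnd
      fun c => isQuasiMorphism_smul_id M (sigmaHatLaurent_constLaurent Fv R c))
    fun c f => Subtype.ext (Algebra.commutes (constLaurent Fv R c) f.1)

/-- `M` has complex multiplication by the commutative semi-simple `Q_v`-algebra `E`, by means of
the embedding `ι : E → QEnd_R(M)`. -/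
structure IsCM (M : LocalShtuka Fv ζ) {E : Type*} [CommRing E] [Algebra Fv⸨X⸩ E]
    (ι : E →ₐ[Fv⸨X⸩] M.QEnd) : Prop where
  isSemisimpleRing : IsSemisimpleRing E
  finite : Module.Finite Fv⸨X⸩ E
  finrank_eq : Module.finrank Fv⸨X⸩ E = M.rank
  injective : Function.Injective ι

end LocalShtuka

end

/-!
Clearing denominators, `(z - ζ) ^ n τ` is the linearization of a `σ̂`-semilinear endomorphism `F`
of `M` for some `n`. The ring `𝒪_E` is finite over `A_v` because `A_v` is complete, so the
`𝒪_E`-span of `M` in `M[1/z]` is again a finitely generated lattice, stable under `𝒪_E` and `F`.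
Saturating it with respect to the complement of the prime ideal `(z)` makes its quotient by `z`
torsion-free over the principal ideal domain `R⟦z⟧/(z)`, hence makes the lattice free, and
keeps it stable. A free lattice is `g⁻¹ M` for an automorphism `g` of `M[1/z]`, and then
`G = g F g⁻¹` preserves `M`. As `det g` is a power of `z` times a unit of `R⟦z⟧`, and `σ̂` fixes
`z`, the determinants of `F` and `G` are associated. So `G`, like `F`, becomes invertible once
`z - ζ` is inverted, and `(z - ζ) ^ (-n) G` gives the required local shtuka structure on `M`.
-/

noncomputable section

namespace LocSht

section CompleteLocalRing

variable {A : Type*} [CommRing A]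

instance isPrecomplete_pi {I : Ideal A} {ι : Type*} [Finite ι] {M : ι → Type*}
    [∀ i, AddCommGroup (M i)] [∀ i, Module A (M i)] [∀ i, IsPrecomplete I (M i)] :
    IsPrecomplete I (∀ i, M i) := by
  classical
  cases nonempty_fintype ι
  refine AdicCompletion.of_surjective_iff.1 fun y => ?_
  choose x hx using fun i => AdicCompletion.of_surjective I (M i) (AdicCompletion.pi I M y i)
  refine ⟨x, (AdicCompletion.piEquivOfFintype I M).injective ?_⟩
  simp only [AdicCompletion.piEquivOfFintype_apply]
  exact funext hx

open IsLocalRing in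
lemma finite_of_isHausdorff [IsLocalRing A] [IsPrecomplete (maximalIdeal A) A] {N : Type*}
    [AddCommGroup N] [Module A N] [Module.Flat A N] [IsHausdorff (maximalIdeal A) N]
    (hN : Module.rank A N < Cardinal.aleph0) : Module.Finite A N := by
  let c := Module.Basis.ofVectorSpace (ResidueField A) (ResidueField A ⊗[A] N)
  obtain ⟨b, hb : _ ∘ b = c⟩ := (TensorProduct.mk_surjective A N (ResidueField A)
    Ideal.Quotient.mk_surjective).comp_left c
  have hli : LinearIndependent A b :=
    Module.IsLocalRing.linearIndependent_of_flat b (by rw [hb]; exact c.linearIndependent)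
  have : Finite (Module.Basis.ofVectorSpaceIndex (ResidueField A) (ResidueField A ⊗[A] N)) :=
    Cardinal.lt_aleph0_iff_finite.1 <| Cardinal.lift_lt_aleph0.1 <|
      hli.cardinal_lift_le_rank.trans_lt (Cardinal.lift_lt_aleph0.2 hN)
  cases nonempty_fintype (Module.Basis.ofVectorSpaceIndex (ResidueField A) (ResidueField A ⊗[A] N))
  have hspan : ⊤ ≤ LinearMap.range
      (TensorProduct.mk A (ResidueField A) N 1 ∘ₗ Fintype.linearCombination A b) := by
    rw [LinearMap.range_comp, Fintype.range_linearCombination, Submodule.map_span, ← Set.range_comp,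
      hb, ← Submodule.restrictScalars_span A (ResidueField A) Ideal.Quotient.mk_surjective,
      c.span_eq, Submodule.restrictScalars_top]
  refine Module.Finite.of_surjective (Fintype.linearCombination A b)
    (surjective_of_mkQ_comp_surjective (I := maximalIdeal A) fun y => ?_)
  obtain ⟨x, hx⟩ := hspan (Submodule.mem_top
    (x := (TensorProduct.quotTensorEquivQuotSMul N (maximalIdeal A)).symm y))
  refine ⟨x, (TensorProduct.quotTensorEquivQuotSMul N (maximalIdeal A)).symm.injective ?_⟩
  rw [← hx]
  exact TensorProduct.quotTensorEquivQuotSMul_symm_mk _ _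

end CompleteLocalRing

section IntegralClosure

variable {A K E : Type*} [CommRing A] [IsDomain A] [IsDiscreteValuationRing A] [Field K]
  [Algebra A K] [IsFractionRing A K] [CommRing E] [Algebra K E] [Algebra A E] [IsScalarTower A K E]

lemma not_isIntegral_inv_algebraMap {ϖ : A} (hϖ : Irreducible ϖ) :
    ¬ IsIntegral A (algebraMap A K ϖ)⁻¹ := by
  intro h
  obtain ⟨f, hf⟩ := IsIntegrallyClosed.isIntegral_iff.1 h
  have hϖ0 : algebraMap A K ϖ ≠ 0 := by simpa using hϖ.ne_zero
  refine hϖ.not_isUnit (IsUnit.of_mul_eq_one f (IsFractionRing.injective A K ?_))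
  rw [map_mul, hf, map_one, mul_inv_cancel₀ hϖ0]

lemma exists_isIntegral_pow_smul [Algebra.IsAlgebraic K E] {ϖ : A} (hϖ : Irreducible ϖ) (x : E) :
    ∃ m : ℕ, IsIntegral A (ϖ ^ m • x) := by
  obtain ⟨⟨s, hs⟩, hx⟩ := IsIntegral.exists_multiple_integral_of_isLocalization
    (nonZeroDivisors A) x (Algebra.IsAlgebraic.isAlgebraic (R := K) x).isIntegral
  obtain ⟨m, u, rfl⟩ := IsDiscreteValuationRing.eq_unit_mul_pow_irreducible
    (nonZeroDivisors.ne_zero hs) hϖ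
  refine ⟨m, ?_⟩
  have := hx.smul (↑u⁻¹ : A)
  rwa [Submonoid.mk_smul, smul_smul, ← mul_assoc, Units.inv_mul, one_mul] at this

lemma eq_zero_of_forall_pow_smul_isIntegral {F : Type*} [Field F] [Algebra K F] [Algebra A F]
    [IsScalarTower A K F] [Algebra.IsAlgebraic K F] {ϖ : A} (hϖ : Irreducible ϖ) {x : F}
    (hx : ∀ n : ℕ, ∃ y, IsIntegral A y ∧ ϖ ^ n • y = x) : x = 0 := by
  by_contra h0
  obtain ⟨m, hm⟩ := exists_isIntegral_pow_smul (K := K) hϖ x⁻¹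
  obtain ⟨y, hy, rfl⟩ := hx (m + 1)
  refine not_isIntegral_inv_algebraMap (K := K) hϖ
    ((isIntegral_algebraMap_iff (algebraMap K F).injective).1 ?_)
  have hy0 : y ≠ 0 := by rintro rfl; simp at h0
  have hϖ0 : algebraMap A F ϖ ≠ 0 := by
    rw [IsScalarTower.algebraMap_apply A K F]
    simpa using hϖ.ne_zero
  have hinv : algebraMap K F (algebraMap A K ϖ)⁻¹ = y * (ϖ ^ m • (ϖ ^ (m + 1) • y)⁻¹) := by
    rw [map_inv₀, ← IsScalarTower.algebraMap_apply]
    simp only [Algebra.smul_def, map_pow]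
    field_simp
    ring
  exact hinv ▸ hy.mul hm

lemma isHausdorff_integralClosure [IsSemisimpleRing E] [Algebra.IsAlgebraic K E] :
    IsHausdorff (IsLocalRing.maximalIdeal A) (integralClosure A E) := by
  obtain ⟨ϖ, hϖ⟩ := IsDiscreteValuationRing.exists_irreducible A
  refine ⟨fun x hx => Subtype.ext ?_⟩
  have hdiv (n : ℕ) : ∃ y : E, IsIntegral A y ∧ ϖ ^ n • y = x := by
    have := hx n
    rw [SModEq.zero, hϖ.maximalIdeal_eq, Ideal.span_singleton_pow,
      Submodule.ideal_span_singleton_smul, Submodule.mem_smul_pointwise_iff_exists] at this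
    obtain ⟨y, -, rfl⟩ := this
    exact ⟨y, y.2, rfl⟩
  have hmem : (x : E) ∈ Ideal.jacobson ⊥ := by
    refine Submodule.mem_sInf.2 fun m ⟨_, hm⟩ => Ideal.Quotient.eq_zero_iff_mem.1 ?_
    let := Ideal.Quotient.field m
    refine eq_zero_of_forall_pow_smul_isIntegral (K := K) hϖ fun n => ?_
    obtain ⟨y, hy, hyx⟩ := hdiv n
    exact ⟨Ideal.Quotient.mkₐ A m y, hy.map _, by rw [← map_smul, hyx]; rfl⟩
  rwa [Ideal.jacobson_bot, IsSemisimpleRing.jacobson_eq_bot] at hmem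

variable (A K E) in
lemma finite_integralClosure [IsAdicComplete (IsLocalRing.maximalIdeal A) A] [IsSemisimpleRing E]
    [Module.Finite K E] : Module.Finite A (integralClosure A E) := by
  have := isHausdorff_integralClosure (A := A) (K := K) (E := E)
  have : Module.IsTorsionFree A E := .trans_faithfulSMul A K E
  have hrank : Module.rank A (integralClosure A E) ≤ Module.rank K E := by
    rw [IsLocalization.rank_eq K (nonZeroDivisors A) le_rfl]
    exact Submodule.rank_le (Subalgebra.toSubmodule (integralClosure A E))
  exact finite_of_isHausdorff (hrank.trans_lt (Module.rank_lt_aleph0 K E))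

instance : IsAdicComplete (IsLocalRing.maximalIdeal K⟦X⟧) K⟦X⟧ := by
  rw [PowerSeries.maximalIdeal_eq_span_X]; infer_instance

end IntegralClosure

section Saturation

variable {A V V' : Type*} [CommRing A] [AddCommGroup V] [Module A V] [AddCommGroup V'] [Module A V']

/-- The `T`-saturation of a submodule `L`: all vectors some multiple of which, by an element of
the multiplicative set `T`, lies in `L`. -/
def saturation (T : Submonoid A) (L : Submodule A V) : Submodule A V :=
  (Submodule.torsion' A (V ⧸ L) T).comap L.mkQ

variable {T : Submonoid A} {L : Submodule A V}

lemma mem_saturation {x : V} : x ∈ saturation T L ↔ ∃ s ∈ T, s • x ∈ L := by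
  simp only [saturation, Submodule.mem_comap, Submodule.mem_torsion'_iff, Submodule.mkQ_apply,
    Submonoid.smul_def, ← Submodule.Quotient.mk_smul, Submodule.Quotient.mk_eq_zero,
    Subtype.exists, exists_prop]

lemma le_saturation : L ≤ saturation T L :=
  fun x hx => mem_saturation.2 ⟨1, T.one_mem, by rwa [one_smul]⟩

lemma saturation_saturation : saturation T (saturation T L) = saturation T L := by
  refine le_antisymm (fun x hx => ?_) le_saturation
  obtain ⟨s, hs, hx⟩ := mem_saturation.1 hx
  obtain ⟨t, ht, hx⟩ := mem_saturation.1 hx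
  exact mem_saturation.2 ⟨t * s, T.mul_mem ht hs, by rwa [mul_smul]⟩

lemma saturation_le_comap {σ : A →+* A} (φ : V →ₛₗ[σ] V') (hT : T ≤ T.comap σ)
    {L' : Submodule A V'} (hφ : L ≤ L'.comap φ) : saturation T L ≤ (saturation T L').comap φ := by
  intro x hx
  obtain ⟨s, hs, hx⟩ := mem_saturation.1 hx
  exact mem_saturation.2 ⟨σ s, hT hs, by simpa using hφ hx⟩

end Saturation

section Lattice

variable {A V : Type*} (K : Type*) [CommRing A] (x : A) [CommRing K] [Algebra A K]
  [IsLocalization.Away x K] [AddCommGroup V] [Module A V] [Module K V] [IsScalarTower A K V]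

open Submodule (IsLattice)
open scoped Pointwise

include K in
lemma isSMulRegular_of_away : IsSMulRegular V x := fun v w h =>
  (IsLocalization.Away.algebraMap_isUnit x (S := K)).isSMulRegular V
    (by simpa only [algebraMap_smul] using! h)

lemma exists_pow_smul_mem (L : Submodule A V) [IsLattice K L] (v : V) :
    ∃ s ∈ Submonoid.powers x, s • v ∈ L := by
  have hv : v ∈ Submodule.span K (L : Set V) := by rw [IsLattice.span_eq_top]; trivial
  rw [← mem_saturation]
  induction hv using Submodule.span_induction with
  | mem v hv => exact le_saturation hv
  | zero => exact zero_mem _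
  | add v w _ _ hv hw => exact add_mem hv hw
  | smul k v _ hv =>
    obtain ⟨n, a, ha⟩ := IsLocalization.Away.surj x k
    obtain ⟨s, hs, hsv⟩ := mem_saturation.1 hv
    refine mem_saturation.2 ⟨s * x ^ n, mul_mem hs ⟨n, rfl⟩, ?_⟩
    rw [← algebraMap_smul K, smul_smul, map_mul, map_pow, mul_assoc, mul_comm _ k, ha, ← map_mul,
      algebraMap_smul, mul_comm, mul_smul]
    exact L.smul_mem a hsv

lemma isLocalizedModule_subtype (L : Submodule A V) [IsLattice K L] :
    IsLocalizedModule (Submonoid.powers x) L.subtype where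
  map_units s := by
    obtain ⟨u, hu⟩ := IsLocalization.map_units K s
    rw [Module.End.isUnit_iff]
    convert MulAction.bijective (β := V) u using 1
    ext v
    rw [Units.smul_def, hu, algebraMap_smul, Module.algebraMap_end_apply]
  surj v :=
    have ⟨s, hs, hv⟩ := exists_pow_smul_mem K x L v
    ⟨⟨⟨_, hv⟩, ⟨s, hs⟩⟩, rfl⟩
  exists_of_eq h := ⟨1, by rw [Subtype.ext h]⟩

lemma exists_pow_smul_le (L P : Submodule A V) [IsLattice K L] (hP : P.FG) :
    ∃ s ∈ Submonoid.powers x, P ≤ L.comap (LinearMap.lsmul A V s) := by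
  induction P, hP using Submodule.fg_induction with
  | singleton v => simpa using exists_pow_smul_mem K x L v
  | sup P Q _ _ hP hQ =>
    obtain ⟨s, hs, hP⟩ := hP
    obtain ⟨t, ht, hQ⟩ := hQ
    refine ⟨t * s, mul_mem ht hs, sup_le (fun v hv => ?_) (fun v hv => ?_)⟩
    · simpa [mul_smul] using L.smul_mem t (hP hv)
    · simpa [mul_comm t, mul_smul] using L.smul_mem s (hQ hv)

include x in
lemma isLattice_saturation [IsNoetherianRing A] {T : Submonoid A} {L P : Submodule A V}
    [IsLattice K L] (hL : saturation T L = L) [IsLattice K P] : IsLattice K (saturation T P) := by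
  obtain ⟨s, hs, hPL⟩ := exists_pow_smul_le K x L P IsLattice.fg
  have hle : saturation T P ≤ L.comap (LinearMap.lsmul A V s) := by
    conv_rhs => rw [← hL]
    exact saturation_le_comap _ le_rfl hPL
  have hinj : Function.Injective ((LinearMap.lsmul A V s).restrict hle) := fun v w h => by
    obtain ⟨n, hn⟩ := hs
    exact Subtype.ext <| (isSMulRegular_of_away K x).pow n <| by
      simpa [← hn] using! congrArg Subtype.val h
  exact .of_le_of_isLattice_of_fg K le_saturation
    (Module.Finite.iff_fg.1 (Module.Finite.of_injective _ hinj))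

include K in
lemma isTorsionFree_quotSMulTop [(Ideal.span {x}).IsPrime] {L : Submodule A V}
    (hL : saturation (Ideal.span {x}).primeCompl L = L) :
    Module.IsTorsionFree (A ⧸ Ideal.span {x}) (QuotSMulTop x L) := by
  refine .of_smul_eq_zero fun s l h => or_iff_not_imp_left.2 fun hs => ?_
  obtain ⟨s, rfl⟩ := Ideal.Quotient.mk_surjective s
  obtain ⟨l, rfl⟩ := Submodule.Quotient.mk_surjective _ l
  have hs : s ∈ (Ideal.span {x}).primeCompl := fun h => hs (Ideal.Quotient.eq_zero_iff_mem.2 h)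
  obtain ⟨v, hv⟩ : ∃ v : V, x • v = l := ⟨IsLocalization.Away.invSelf x (S := K) • (l : V), by
    rw [← algebraMap_smul K, smul_smul, IsLocalization.Away.mul_invSelf, one_smul]⟩
  obtain ⟨m, -, hm⟩ := (Submodule.mem_smul_pointwise_iff_exists _ _ _).1
    ((Submodule.Quotient.mk_eq_zero (x • (⊤ : Submodule A L)) (x := s • l)).1 h)
  have hsv : s • v = m := isSMulRegular_of_away K x <| by
    dsimp only
    rw [smul_comm, hv]; exact congrArg Subtype.val hm.symm
  have hvL : v ∈ L := hL ▸ mem_saturation.2 ⟨s, hs, hsv ▸ m.2⟩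
  exact (Submodule.Quotient.mk_eq_zero _).2
    ((Submodule.mem_smul_pointwise_iff_exists _ _ _).2 ⟨⟨v, hvL⟩, trivial, Subtype.ext hv⟩)

lemma saturation_eq_of_isTorsionFree [(Ideal.span {x}).IsPrime] {L : Submodule A V} [IsLattice K L]
    [Module.IsTorsionFree (A ⧸ Ideal.span {x}) (QuotSMulTop x L)] :
    saturation (Ideal.span {x}).primeCompl L = L := by
  refine le_antisymm (fun v hv => ?_) le_saturation
  obtain ⟨s, hs, hsv⟩ := mem_saturation.1 hv
  obtain ⟨_, ⟨n, rfl⟩, hn⟩ := exists_pow_smul_mem K x L v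
  clear hv
  dsimp only at hn
  induction n generalizing v with
  | zero => simpa using hn
  | succ n ih =>
    have hw : Submodule.Quotient.mk (p := x • (⊤ : Submodule A L)) ⟨x ^ (n + 1) • v, hn⟩ = 0 := by
      have hs0 : Ideal.Quotient.mk (.span {x}) s ≠ 0 := mt Ideal.Quotient.eq_zero_iff_mem.1 hs
      refine (smul_eq_zero_iff_right hs0).1 ((Submodule.Quotient.mk_eq_zero _).2 ?_)
      refine (Submodule.mem_smul_pointwise_iff_exists _ _ _).2
        ⟨⟨x ^ n • s • v, L.smul_mem _ hsv⟩, trivial, Subtype.ext ?_⟩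
      change x • x ^ n • s • v = s • x ^ (n + 1) • v
      rw [smul_smul, smul_smul, smul_smul, ← pow_succ', mul_comm]
    obtain ⟨w, -, hw⟩ := (Submodule.mem_smul_pointwise_iff_exists _ _ _).1
      ((Submodule.Quotient.mk_eq_zero _).1 hw)
    refine ih v hsv ?_
    have : x • x ^ n • v = x • (w : V) := by
      rw [smul_smul, ← pow_succ']
      exact (congrArg Subtype.val hw).symm
    rw [isSMulRegular_of_away K x this]
    exact w.2

lemma free_iff_saturation_eq [IsNoetherianRing A] [(Ideal.span {x}).IsPrime]
    [IsPrincipalIdealRing (A ⧸ Ideal.span {x})] (hx : x ∈ (⊥ : Ideal A).jacobson)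
    (L : Submodule A V) [IsLattice K L] :
    Module.Free A L ↔ saturation (Ideal.span {x}).primeCompl L = L := by
  refine ⟨fun _ => saturation_eq_of_isTorsionFree K x, fun hL => ?_⟩
  have := Module.finitePresentation_of_finite A L
  have := Module.Finite.of_restrictScalars_finite A (A ⧸ Ideal.span {x}) (QuotSMulTop x L)
  have := isTorsionFree_quotSMulTop K x hL
  refine (Module.free_quotSMulTop_iff_free A L hx fun v w h => ?_).1 inferInstance
  exact Subtype.ext (isSMulRegular_of_away K x (congrArg Subtype.val h))

section FreeLattice

variable {M N : Type*} [AddCommGroup M] [Module A M] [AddCommGroup N] [Module A N]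
  (f : M →ₗ[A] V) (f' : N →ₗ[A] V) [IsLocalizedModule (.powers x) f]
  [IsLocalizedModule (.powers x) f']

include x in
lemma isLattice_range [Module.Finite A M] : IsLattice K (LinearMap.range f) where
  fg := Module.Finite.iff_fg.1 inferInstance
  span_eq_top := by
    have := span_eq_top_of_isLocalizedModule K (.powers x) f (v := .univ) (by simp)
    rwa [Set.image_univ] at this

lemma exists_linearEquiv_map_range_eq [Nontrivial A] (hx : x ∈ nonZeroDivisors A)
    [Module.Free A M] [Module.Finite A M] [Module.Free A N] [Module.Finite A N] :
    ∃ g : V ≃ₗ[K] V, (LinearMap.range f).map (g.restrictScalars A : V →ₗ[A] V) =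
      LinearMap.range f' := by
  have hfin : Module.finrank A M = Module.finrank A N := by
    have h := Submonoid.powers_le.2 hx
    rw [← IsLocalizedModule.finrank_eq _ f h, IsLocalizedModule.finrank_eq _ f' h]
  let b := Module.finBasisOfFinrankEq A M hfin
  let c := Module.finBasis A N
  let b' := b.ofIsLocalizedModule K (.powers x) f
  let c' := c.ofIsLocalizedModule K (.powers x) f'
  refine ⟨b'.equiv c' (.refl _), ?_⟩
  rw [← b.ofIsLocalizedModule_span K (.powers x) f, Submodule.map_span, ← Set.range_comp,
    ← c.ofIsLocalizedModule_span K (.powers x) f']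
  congr 2
  ext i
  exact b'.equiv_apply i c' (.refl _)

lemma exists_linearEquiv_map_range_eq_saturation [IsNoetherianRing A] [(Ideal.span {x}).IsPrime]
    [IsPrincipalIdealRing (A ⧸ Ideal.span {x})] (hx : x ∈ (⊥ : Ideal A).jacobson)
    (hx₀ : x ∈ nonZeroDivisors A) [Module.Free A M] [Module.Finite A M]
    (P : Submodule A V) [IsLattice K P] :
    ∃ g : V ≃ₗ[K] V, (LinearMap.range f).map (g.restrictScalars A : V →ₗ[A] V) =
      saturation (Ideal.span {x}).primeCompl P := by
  have hf : Function.Injective f := (IsLocalizedModule.injective_iff_isRegular (.powers x) f).2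
    fun s => (le_nonZeroDivisors_iff_isRegular.1 (Submonoid.powers_le.2 hx₀) s).isSMulRegular
  have := (Ideal.Quotient.mk (Ideal.span {x})).domain_nontrivial
  have := isLattice_range K x f
  have := Module.Free.of_equiv (LinearEquiv.ofInjective f hf)
  have := isLattice_saturation K x (P := P)
    ((free_iff_saturation_eq K x hx (LinearMap.range f)).1 this)
  have := (free_iff_saturation_eq K x hx _).2 (saturation_saturation (L := P))
  have := isLocalizedModule_subtype K x (saturation (Ideal.span {x}).primeCompl P)
  simpa using exists_linearEquiv_map_range_eq K x f (Submodule.subtype _) hx₀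

end FreeLattice

end Lattice

section StableLattice

open Submodule (IsLattice)

variable {A C V : Type*} [CommRing A] [AddCommGroup V] [Module A V] [CommSemiring C]

lemma fg_iSup_map {O : Type*} [AddCommMonoid O] [Module C O] [Module.Finite C O] {c : C →+* A}
    (ρ : O →ₛₗ[c] Module.End A V) {L : Submodule A V} (hL : L.FG) : (⨆ a, L.map (ρ a)).FG := by
  obtain ⟨s, hs⟩ := Module.Finite.fg_top (R := C) (M := O)
  suffices h : ⨆ a, L.map (ρ a) = ⨆ a : s, L.map (ρ a) by
    rw [h]
    exact Submodule.fg_iSup _ fun a => hL.map _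
  refine le_antisymm (iSup_le fun a => ?_) (iSup_le fun a => le_iSup (fun a => L.map (ρ a)) a.1)
  have ha : a ∈ Submodule.span C (s : Set O) := hs ▸ trivial
  rw [Submodule.map_le_iff_le_comap]
  intro v hv
  induction ha using Submodule.span_induction with
  | mem a ha => exact Submodule.mem_iSup_of_mem ⟨a, ha⟩ (Submodule.mem_map_of_mem hv)
  | zero => simp
  | add a b _ _ ha hb =>
    rw [Submodule.mem_comap, map_add, LinearMap.add_apply]
    exact add_mem ha hb
  | smul r a _ ha => simpa using Submodule.smul_mem _ (c r) ha

variable {K O : Type*} [CommRing K] [Algebra A K] [Module K V] [IsScalarTower A K V] [Semiring O]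
  [Module C O] [Module.Finite C O] {c : C →+* A} (ρ : O →+* Module.End K V)
  (hρ : ∀ (r : C) (a : O), ρ (r • a) = algebraMap A K (c r) • ρ a)
  {σ : A →+* A} (φ : V →ₛₗ[σ] V) (hφ : ∀ a v, φ (ρ a v) = ρ a (φ v))

include hρ hφ

lemma exists_isLattice_le_comap {L : Submodule A V} [IsLattice K L] (hL : L ≤ L.comap φ) :
    ∃ P : Submodule A V, IsLattice K P ∧ (∀ a, P ≤ P.comap ((ρ a).restrictScalars A)) ∧
      P ≤ P.comap φ := by
  let ρ' : O →ₛₗ[c] Module.End A V :=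
    { toFun a := (ρ a).restrictScalars A
      map_add' a b := by rw [map_add]; rfl
      map_smul' r a := by ext v; simp [hρ] }
  have hmap (a : O) : L.map (ρ' a) ≤ ⨆ a, L.map (ρ' a) := le_iSup (fun a => L.map (ρ' a)) a
  have hle : L ≤ ⨆ a, L.map (ρ' a) := fun v hv => hmap 1 ⟨v, hv, by simp [ρ']⟩
  refine ⟨⨆ a, L.map (ρ' a), .of_le_of_isLattice_of_fg K hle (fg_iSup_map ρ' IsLattice.fg),
    fun b => iSup_le fun a => ?_, iSup_le fun a => ?_⟩
  · rintro _ ⟨v, hv, rfl⟩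
    exact hmap (b * a) ⟨v, hv, by simp [ρ']⟩
  · rintro _ ⟨v, hv, rfl⟩
    exact hmap a ⟨φ v, hL hv, (hφ a v).symm⟩

lemma exists_linearEquiv_conj_mem_range (x : A) [IsLocalization.Away x K] [IsNoetherianRing A]
    [(Ideal.span {x}).IsPrime] [IsPrincipalIdealRing (A ⧸ Ideal.span {x})]
    (hx : x ∈ (⊥ : Ideal A).jacobson) (hx₀ : x ∈ nonZeroDivisors A)
    (hσ : (Ideal.span {x}).primeCompl ≤ (Ideal.span {x}).primeCompl.comap σ)
    {M : Type*} [AddCommGroup M] [Module A M] [Module.Free A M] [Module.Finite A M]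
    (f : M →ₗ[A] V) [IsLocalizedModule (.powers x) f]
    (hf : LinearMap.range f ≤ (LinearMap.range f).comap φ) :
    ∃ g : V ≃ₗ[K] V,
      (∀ a, ∀ v ∈ LinearMap.range f, g (ρ a (g.symm v)) ∈ LinearMap.range f) ∧
      ∀ v ∈ LinearMap.range f, g (φ (g.symm v)) ∈ LinearMap.range f := by
  have := isLattice_range K x f
  obtain ⟨P, _, hP, hPφ⟩ := exists_isLattice_le_comap ρ hρ φ hφ hf
  obtain ⟨g, hg⟩ := exists_linearEquiv_map_range_eq_saturation K x f hx hx₀ P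
  have hmem {v : V} : v ∈ LinearMap.range f ↔ g v ∈ saturation (Ideal.span {x}).primeCompl P := by
    rw [← hg]
    exact (g.injective.mem_set_image (s := LinearMap.range f)).symm
  refine ⟨g.symm, fun a v hv => hmem.2 ?_, fun v hv => hmem.2 ?_⟩
  · simpa using! saturation_le_comap _ le_rfl (hP a) (hmem.1 hv)
  · simpa using saturation_le_comap φ hσ hPφ (hmem.1 hv)

end StableLattice

section BaseChange

variable {S P B M N : Type*} [CommRing S] [CommRing P] [CommRing B] [Algebra S P] [Algebra S B]
  [AddCommGroup M] [Module S M] [AddCommGroup N] [Module S N]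

lemma mk_one_injective [Module.Flat S M] (h : Function.Injective (algebraMap S P)) :
    Function.Injective (TensorProduct.mk S P M 1) := by
  have := (Module.Flat.rTensor_preserves_injective_linearMap (M := M)
    (Algebra.linearMap S P) h).comp (TensorProduct.lid S M).symm.injective
  convert this using 1
  ext m
  simp

instance isLocalizedModule_mk (T : Submonoid S) [IsLocalization T P] :
    IsLocalizedModule T (TensorProduct.mk S P M 1) :=
  (isLocalizedModule_iff_isBaseChange T P _).2 (TensorProduct.isBaseChange S M P)

lemma exists_pow_smul_eq_baseChange [Module.FinitePresentation S M] (x : S)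
    [IsLocalization.Away x P] (g : P ⊗[S] M →ₗ[P] P ⊗[S] N) :
    ∃ (n : ℕ) (h : M →ₗ[S] N), x ^ n • g = h.baseChange P := by
  obtain ⟨h, ⟨_, n, rfl⟩, e⟩ := Module.FinitePresentation.exists_lift_of_isLocalizedModule
    (.powers x) (TensorProduct.mk S P N 1) (g.restrictScalars S ∘ₗ TensorProduct.mk S P M 1)
  refine ⟨n, h, TensorProduct.AlgebraTensorModule.curry_injective (LinearMap.ext_ring ?_)⟩
  ext m
  simpa using! (LinearMap.congr_fun e m).symm

lemma extendScalars_baseChange (φ : P →ₐ[S] B) (h : M →ₗ[S] N) :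
    extendScalars φ (h.baseChange P) = h.baseChange B := by
  ext m
  simp [extendScalars_one_tmul]

lemma extendScalars_smul (φ : P →ₐ[S] B) (s : S) (g : P ⊗[S] M →ₗ[P] P ⊗[S] N) :
    extendScalars φ (s • g) = s • extendScalars φ g := by
  ext m
  simp [extendScalars_one_tmul]

lemma extendScalars_injective [Module.Flat S N] {φ : P →ₐ[S] B} (hφ : Function.Injective φ) :
    Function.Injective (extendScalars φ : (P ⊗[S] M →ₗ[P] P ⊗[S] N) → _) := fun g h e => by
  ext m
  have := LinearMap.congr_fun e (1 ⊗ₜ m)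
  rw [extendScalars_one_tmul, extendScalars_one_tmul] at this
  exact Module.Flat.rTensor_preserves_injective_linearMap φ.toLinearMap hφ this

end BaseChange

section PullbackBasis

variable {S : Type*} [CommRing S] {σ : S →+* S} {M I : Type*} [AddCommGroup M] [Module S M]

variable (σ) in
/-- The basis `1 ⊗ b i` of `σ^* M` attached to a basis `b` of `M`. -/
def pullbackBasis (b : Module.Basis I S M) : Module.Basis I S (Pullback σ M) :=
  let b' : Module.Basis I (Twist σ) (Pullback σ M) := Algebra.TensorProduct.basis (Twist σ) b
  b'.mapCoeffs (toTwist σ).symm fun _ _ => rfl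

lemma pullbackBasis_apply (b : Module.Basis I S M) (i : I) :
    pullbackBasis σ b i = pullbackMk σ (b i) :=
  (Module.Basis.mapCoeffs_apply _ (toTwist σ).symm (fun _ _ => rfl) i).trans
    (Algebra.TensorProduct.basis_apply b i)

instance [Module.Free S M] : Module.Free S (Pullback σ M) :=
  .of_basis (pullbackBasis σ (Module.Free.chooseBasis S M))

instance [Module.Free S M] [Module.Finite S M] : Module.Finite S (Pullback σ M) :=
  .of_basis (pullbackBasis σ (Module.Free.chooseBasis S M))

variable [Fintype I] [DecidableEq I] (b : Module.Basis I S M)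

lemma det_toMatrix_pullbackLift (φ : M →ₛₗ[σ] M) :
    (LinearMap.toMatrix (pullbackBasis σ b) b (pullbackLift φ)).det = b.det (φ ∘ b) := by
  rw [Module.Basis.det_apply]
  congr 1
  ext i j
  rw [LinearMap.toMatrix_apply, pullbackBasis_apply, pullbackLift_mk, Module.Basis.toMatrix_apply,
    Function.comp_apply]

lemma det_semilinearMap_comp (φ : M →ₛₗ[σ] M) (v : I → M) :
    b.det (φ ∘ v) = σ (b.det v) * b.det (φ ∘ b) := by
  have h : b.toMatrix (φ ∘ v) = b.toMatrix (φ ∘ b) * (b.toMatrix v).map σ := by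
    ext i j
    conv_lhs => rw [Module.Basis.toMatrix_apply, Function.comp_apply, ← b.sum_repr (v j), map_sum]
    simp [Matrix.mul_apply, Module.Basis.toMatrix_apply, mul_comm]
  rw [Module.Basis.det_apply, h, Matrix.det_mul, mul_comm, ← RingHom.mapMatrix_apply,
    ← RingHom.map_det, Module.Basis.det_apply, Module.Basis.det_apply]

end PullbackBasis

section LaurentUnit

lemma exists_mul_pow_eq_of_isUnit {A K : Type*} [CommRing A] [IsDomain A] [CommRing K] [Algebra A K]
    {x : A} (hx : Prime x) [IsLocalization.Away x K] {a : K} (ha : IsUnit a) :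
    ∃ (k m : ℕ) (u : Aˣ), a * algebraMap A K x ^ k = algebraMap A K (x ^ m * u) := by
  obtain ⟨k, s, hs⟩ := IsLocalization.Away.surj x a
  obtain ⟨n, hn⟩ := (IsLocalization.Away.algebraMap_isUnit_iff (S := K) x).1
    (hs ▸ ha.mul ((IsLocalization.Away.algebraMap_isUnit x).pow k))
  obtain ⟨m, -, h⟩ := (dvd_prime_pow hx n).1 hn
  obtain ⟨u, rfl⟩ := h.symm
  exact ⟨k, m, u, hs⟩

lemma associated_of_mul_eq_laurentMap_mul {R : Type*} [CommRing R] [IsDomain R] (f : R →+* R)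
    {a : R⸨X⸩} (ha : IsUnit a) {s t : R⟦X⟧}
    (h : a * algebraMap R⟦X⟧ R⸨X⸩ s = laurentMap f a * algebraMap R⟦X⟧ R⸨X⸩ t) :
    Associated s t := by
  obtain ⟨k, m, u, hu⟩ := exists_mul_pow_eq_of_isUnit (PowerSeries.X_prime (R := R)) ha
  have hfu := congrArg (laurentMap f) hu
  simp only [map_mul, map_pow, laurentMap_algebraMap, PowerSeries.map_X] at hu hfu
  have hinj : Function.Injective (algebraMap R⟦X⟧ R⸨X⸩) := HahnSeries.ofPowerSeries_injective
  have hst : PowerSeries.X ^ m * (s * (u : R⟦X⟧)) =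
      PowerSeries.X ^ m * (t * PowerSeries.map f u) := by
    apply hinj
    simp only [map_mul, map_pow]
    linear_combination algebraMap R⟦X⟧ R⸨X⸩ PowerSeries.X ^ k * h -
      algebraMap R⟦X⟧ R⸨X⸩ s * hu + algebraMap R⟦X⟧ R⸨X⸩ t * hfu
  have := mul_left_cancel₀ (pow_ne_zero m PowerSeries.X_prime.ne_zero) hst
  exact (associated_mul_unit_right s u u.isUnit).trans <| this.symm ▸
    associated_mul_unit_left t _ (u.isUnit.map (PowerSeries.map f))

end LaurentUnit

section Laurent

variable {R : Type*} [CommRing R]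

variable {Fv : Type*} [Field Fv] [Fintype Fv] [Algebra Fv R]
  {M N : Type*} [AddCommGroup M] [Module R⟦X⟧ M] [AddCommGroup N] [Module R⟦X⟧ N]

/-- The extension `F[1/z] : M[1/z] → N[1/z]` of a `σ̂`-semilinear map `F : M → N`. -/
def laurentExtend (F : M →ₛₗ[sigmaHat Fv R] N) :
    R⸨X⸩ ⊗[R⟦X⟧] M →ₛₗ[sigmaHatLaurent Fv R] R⸨X⸩ ⊗[R⟦X⟧] N where
  toFun := (pullbackLift F).baseChange R⸨X⸩ ∘ pullbackMkLaurent Fv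
  map_add' x y := by simp
  map_smul' p x := by simp [pullbackMkLaurent_smul]

lemma laurentExtend_apply (F : M →ₛₗ[sigmaHat Fv R] N) (x : R⸨X⸩ ⊗[R⟦X⟧] M) :
    laurentExtend F x = (pullbackLift F).baseChange R⸨X⸩ (pullbackMkLaurent Fv x) := rfl

lemma laurentExtend_one_tmul (F : M →ₛₗ[sigmaHat Fv R] N) (m : M) :
    laurentExtend F (1 ⊗ₜ m) = 1 ⊗ₜ F m := by
  simp [laurentExtend_apply, pullbackMkLaurent, sigmaHatLaurentₛₗ]

end Laurent

lemma X_sub_C_ne_zero {R : Type*} [CommRing R] [Nontrivial R] (ζ : R) :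
    (PowerSeries.X - PowerSeries.C ζ : R⟦X⟧) ≠ 0 := fun h => by
  simpa [PowerSeries.coeff_C] using congrArg (PowerSeries.coeff 1) h

lemma isUnit_algebraMap_awayZeta_pow {R : Type*} [CommRing R] (ζ : R) (n : ℕ) :
    IsUnit (algebraMap R⟦X⟧ (AwayZeta ζ) ((PowerSeries.X - PowerSeries.C ζ) ^ n)) := by
  rw [map_pow]
  exact (IsLocalization.Away.algebraMap_isUnit _).pow n

lemma laurentToBoth_injective {R : Type*} [CommRing R] [IsDomain R] (ζ : R) :
    Function.Injective (laurentToBoth ζ) := by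
  refine IsLocalization.injective (M := Submonoid.powers
    (algebraMap R⟦X⟧ R⸨X⸩ (PowerSeries.X - PowerSeries.C ζ))) _
    (powers_le_nonZeroDivisors_of_noZeroDivisors ?_)
  exact (map_ne_zero_iff _ HahnSeries.ofPowerSeries_injective).2 (X_sub_C_ne_zero ζ)

end LocSht

namespace LocalShtuka

open LocSht

variable {Fv R : Type*} [Field Fv] [Fintype Fv] [CommRing R] [Algebra Fv R] {ζ : R}
  {M N : LocalShtuka Fv ζ} {n : ℕ} {F : M.carrier →ₛₗ[sigmaHat Fv R] M.carrier}
  {G : N.carrier →ₛₗ[sigmaHat Fv R] N.carrier}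

/-- `F` is an integral Frobenius of `M` of order `n`: a `σ̂`-semilinear endomorphism of `M` itself
whose linearization is `(z - ζ) ^ n τ`. -/
def IsFrobenius (M : LocalShtuka Fv ζ) (n : ℕ)
    (F : M.carrier →ₛₗ[sigmaHat Fv R] M.carrier) : Prop :=
  (PowerSeries.X - PowerSeries.C ζ : R⟦X⟧) ^ n • (M.τ : _ →ₗ[AwayZeta ζ] _) =
    (pullbackLift F).baseChange (AwayZeta ζ)

lemma exists_isFrobenius (M : LocalShtuka Fv ζ) : ∃ n F, M.IsFrobenius n F := by
  have := Module.finitePresentation_of_projective R⟦X⟧ (Pullback (sigmaHat Fv R) M.carrier)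
  obtain ⟨n, T, hT⟩ := exists_pow_smul_eq_baseChange (PowerSeries.X - PowerSeries.C ζ)
    M.τ.toLinearMap
  refine ⟨n, T.comp (pullbackMk _), hT.trans ?_⟩
  congr 1
  exact pullback_hom_ext fun m => by simp

lemma isMorphism_of_isFrobenius (hF : M.IsFrobenius n F) (hG : N.IsFrobenius n G)
    {f : M.carrier →ₗ[R⟦X⟧] N.carrier} (hf : ∀ m, f (F m) = G (f m)) : IsMorphism M N f := by
  have hu := isUnit_algebraMap_awayZeta_pow ζ n
  have h : pullbackLift G ∘ₗ pullbackMap (sigmaHat Fv R) f = f ∘ₗ pullbackLift F :=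
    pullback_hom_ext fun m => by simp [hf]
  rw [IsMorphism, ← hu.smul_left_cancel, algebraMap_smul, algebraMap_smul, ← LinearMap.smul_comp,
    ← LinearMap.comp_smul, hF, hG, ← LinearMap.baseChange_comp, h, LinearMap.baseChange_comp]

lemma smul_extendScalars_eq (hF : M.IsFrobenius n F) :
    (PowerSeries.X - PowerSeries.C ζ : R⟦X⟧) ^ n •
        extendScalars (zetaToBoth ζ) (M.τ : _ →ₗ[AwayZeta ζ] _) =
      extendScalars (laurentToBoth ζ) ((pullbackLift F).baseChange R⸨X⸩) := by
  rw [← extendScalars_smul, hF, extendScalars_baseChange, extendScalars_baseChange]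

lemma isQuasiMorphism_iff [IsDomain R] (hF : M.IsFrobenius n F) (hG : N.IsFrobenius n G)
    (f : M.Laurent →ₗ[R⸨X⸩] N.Laurent) :
    IsQuasiMorphism M N f ↔ ∀ x, f (laurentExtend F x) = laurentExtend G (f x) := by
  have hu : IsUnit (algebraMap R⟦X⟧ (AwayBoth ζ) ((PowerSeries.X - PowerSeries.C ζ) ^ n)) := by
    simpa using (isUnit_algebraMap_awayZeta_pow ζ n).map (zetaToBoth ζ)
  rw [IsQuasiMorphism, ← hu.smul_left_cancel, algebraMap_smul, algebraMap_smul,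
    ← LinearMap.smul_comp, ← LinearMap.comp_smul, smul_extendScalars_eq hF,
    smul_extendScalars_eq hG, ← extendScalars_comp, ← extendScalars_comp,
    (extendScalars_injective (laurentToBoth_injective ζ)).eq_iff]
  refine ⟨fun h x => ?_, fun h => laurent_hom_ext Fv fun m => ?_⟩
  · simp only [laurentExtend_apply, ← pullbackMapLaurent_mk]
    exact (LinearMap.congr_fun h (pullbackMkLaurent Fv x)).symm
  · have := h (1 ⊗ₜ m)
    rw [laurentExtend_one_tmul, laurentExtend_apply] at this
    simp [pullbackMapLaurent_one_tmul, this]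

end LocalShtuka

namespace LocSht

lemma exists_semilinearMap_comp_eq {S S' M N V : Type*} [Semiring S] [Semiring S']
    [AddCommMonoid M] [Module S M] [AddCommMonoid N] [Module S' N] [AddCommMonoid V] [Module S' V]
    {σ : S →+* S'} {i : N →ₗ[S'] V} (hi : Function.Injective i) (ψ : M →ₛₗ[σ] V)
    (h : ∀ m, ψ m ∈ LinearMap.range i) : ∃ F : M →ₛₗ[σ] N, ∀ m, i (F m) = ψ m :=
  ⟨(LinearEquiv.ofInjective i hi).symm.toLinearMap.comp (ψ.codRestrict _ h), fun m =>
    congrArg Subtype.val ((LinearEquiv.ofInjective i hi).apply_symm_apply ⟨ψ m, h m⟩)⟩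

lemma semilinearMap_baseChange_ext {S P Q M V : Type*} [CommRing S] [CommRing P] [Algebra S P]
    [Semiring Q] [AddCommGroup M] [Module S M] [AddCommMonoid V] [Module Q V] {τ : P →+* Q}
    {f g : P ⊗[S] M →ₛₗ[τ] V} (h : ∀ m, f (1 ⊗ₜ m) = g (1 ⊗ₜ m)) : f = g := by
  ext x
  induction x with
  | zero => simp
  | tmul p m =>
    have : p ⊗ₜ[S] m = p • (1 ⊗ₜ[S] m) := by simp [TensorProduct.smul_tmul']
    rw [this, map_smulₛₗ, map_smulₛₗ, h]
  | add x y hx hy => rw [map_add, map_add, hx, hy]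

lemma exists_linearEquiv_smul_eq {I S P Q : Type*} [Fintype I] [DecidableEq I] [CommRing S]
    [AddCommGroup P] [Module S P] [AddCommGroup Q] [Module S Q] (b : Module.Basis I S P)
    (c : Module.Basis I S Q) {s : S} (hs : IsUnit s) {f : P →ₗ[S] Q}
    (hf : IsUnit (LinearMap.toMatrix b c f).det) :
    ∃ e : P ≃ₗ[S] Q, s • (e : P →ₗ[S] Q) = f := by
  obtain ⟨s, rfl⟩ := hs
  refine ⟨(LinearEquiv.ofIsUnitDet hf).trans (LinearEquiv.smulOfUnit s⁻¹), ?_⟩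
  ext x
  exact smul_inv_smul s (f x)

section Laurent

variable {Fv R M N : Type*} [Field Fv] [Fintype Fv] [CommRing R] [Algebra Fv R]
  [AddCommGroup M] [Module R⟦X⟧ M] [AddCommGroup N] [Module R⟦X⟧ N]

lemma mk_one_laurent_injective [Module.Flat R⟦X⟧ M] :
    Function.Injective (TensorProduct.mk R⟦X⟧ R⸨X⸩ M 1) :=
  mk_one_injective HahnSeries.ofPowerSeries_injective

/-- A `σ̂`-semilinear map of `z`-localized modules, with scalars restricted to `R⟦z⟧`. -/
def restrictLaurent (ψ : R⸨X⸩ ⊗[R⟦X⟧] M →ₛₗ[sigmaHatLaurent Fv R] R⸨X⸩ ⊗[R⟦X⟧] N) :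
    R⸨X⸩ ⊗[R⟦X⟧] M →ₛₗ[sigmaHat Fv R] R⸨X⸩ ⊗[R⟦X⟧] N where
  toFun := ψ
  map_add' := map_add ψ
  map_smul' s x := by
    have hs : sigmaHatLaurent Fv R (algebraMap R⟦X⟧ R⸨X⸩ s) =
        algebraMap R⟦X⟧ R⸨X⸩ (sigmaHat Fv R s) := laurentMap_algebraMap _ s
    rw [← algebraMap_smul R⸨X⸩, map_smulₛₗ, hs, algebraMap_smul]

lemma exists_laurentExtend_eq [Module.Flat R⟦X⟧ N]
    (ψ : R⸨X⸩ ⊗[R⟦X⟧] M →ₛₗ[sigmaHatLaurent Fv R] R⸨X⸩ ⊗[R⟦X⟧] N)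
    (h : ∀ m, ψ (1 ⊗ₜ m) ∈ LinearMap.range (TensorProduct.mk R⟦X⟧ R⸨X⸩ N 1)) :
    ∃ F : M →ₛₗ[sigmaHat Fv R] N, laurentExtend F = ψ := by
  obtain ⟨F, hF⟩ := exists_semilinearMap_comp_eq mk_one_laurent_injective
    ((restrictLaurent ψ).comp (TensorProduct.mk R⟦X⟧ R⸨X⸩ M 1)) h
  exact ⟨F, semilinearMap_baseChange_ext fun m => (laurentExtend_one_tmul F m).trans (hF m)⟩

lemma associated_det_of_conj [IsDomain R] {I : Type*} [Fintype I] [DecidableEq I]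
    (b : Module.Basis I R⟦X⟧ M) {F G : M →ₛₗ[sigmaHat Fv R] M}
    (g : (R⸨X⸩ ⊗[R⟦X⟧] M) ≃ₗ[R⸨X⸩] R⸨X⸩ ⊗[R⟦X⟧] M)
    (h : ∀ x, g (laurentExtend F x) = laurentExtend G (g x)) :
    Associated (b.det (F ∘ b)) (b.det (G ∘ b)) := by
  let bL : Module.Basis I R⸨X⸩ (R⸨X⸩ ⊗[R⟦X⟧] M) := Algebra.TensorProduct.basis R⸨X⸩ b
  have hbL i : bL i = 1 ⊗ₜ b i := Algebra.TensorProduct.basis_apply b i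
  have hdet (H : M →ₛₗ[sigmaHat Fv R] M) :
      bL.det (laurentExtend H ∘ bL) = algebraMap R⟦X⟧ R⸨X⸩ (b.det (H ∘ b)) := by
    rw [Module.Basis.det_apply, Module.Basis.det_apply, RingHom.map_det]
    congr 1
    ext i j
    simp [Module.Basis.toMatrix_apply, hbL, laurentExtend_one_tmul, bL,
      Algebra.TensorProduct.basis_repr_tmul]
  have hg := bL.det_comp g.toLinearMap bL
  rw [bL.det_self, mul_one] at hg
  have hgF := bL.det_comp g.toLinearMap (laurentExtend F ∘ bL)
  have hGg := det_semilinearMap_comp bL (laurentExtend G) (g.toLinearMap ∘ bL)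
  refine associated_of_mul_eq_laurentMap_mul (frob Fv R) (LinearEquiv.isUnit_det' g) ?_
  rw [hg, hdet] at hGg
  rw [hdet] at hgF
  refine hgF.symm.trans (Eq.trans ?_ hGg)
  exact congrArg bL.det (funext fun i => h (bL i))

end Laurent

end LocSht

namespace LocalShtuka

open LocSht

variable {Fv : Type u} {R : Type v} [Field Fv] [Fintype Fv] [CommRing R] [Algebra Fv R] {ζ : R}
  {I : Type*} [Fintype I] [DecidableEq I] {M : LocalShtuka.{u, v, w} Fv ζ} {n : ℕ}
  {F G : M.carrier →ₛₗ[sigmaHat Fv R] M.carrier}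

/-- The local shtuka with the underlying module of `M` and the isomorphism `τ`. -/
def withTau (M : LocalShtuka.{u, v, w} Fv ζ)
    (τ : AwayZeta ζ ⊗[R⟦X⟧] Pullback (sigmaHat Fv R) M.carrier ≃ₗ[AwayZeta ζ]
      AwayZeta ζ ⊗[R⟦X⟧] M.carrier) : LocalShtuka.{u, v, w} Fv ζ where
  carrier := M.carrier
  τ := τ

lemma isUnit_det_of_isFrobenius (hF : M.IsFrobenius n F) (b : Module.Basis I R⟦X⟧ M.carrier) :
    IsUnit (algebraMap R⟦X⟧ (AwayZeta ζ) (b.det (F ∘ b))) := by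
  obtain ⟨u, hu⟩ := isUnit_algebraMap_awayZeta_pow ζ n
  have h := (M.τ.trans (LinearEquiv.smulOfUnit u)).isUnit_det
    (Algebra.TensorProduct.basis _ (pullbackBasis (sigmaHat Fv R) b))
    (Algebra.TensorProduct.basis _ b)
  have e : (M.τ.trans (LinearEquiv.smulOfUnit u) : _ →ₗ[AwayZeta ζ] _) =
      (pullbackLift F).baseChange (AwayZeta ζ) := by
    rw [← hF, ← algebraMap_smul (AwayZeta ζ), ← hu]
    rfl
  rwa [e, LinearMap.toMatrix_baseChange, ← RingHom.mapMatrix_apply, ← RingHom.map_det,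
    det_toMatrix_pullbackLift] at h

lemma exists_isFrobenius_withTau (b : Module.Basis I R⟦X⟧ M.carrier)
    (hF : IsUnit (algebraMap R⟦X⟧ (AwayZeta ζ) (b.det (F ∘ b)))) (n : ℕ) :
    ∃ τ, (M.withTau τ).IsFrobenius n F := by
  obtain ⟨τ, hτ⟩ := exists_linearEquiv_smul_eq
    (Algebra.TensorProduct.basis (AwayZeta ζ) (pullbackBasis (sigmaHat Fv R) b))
    (Algebra.TensorProduct.basis (AwayZeta ζ) b) (isUnit_algebraMap_awayZeta_pow ζ n)
    (f := (pullbackLift F).baseChange (AwayZeta ζ)) (by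
      rwa [LinearMap.toMatrix_baseChange, ← RingHom.mapMatrix_apply, ← RingHom.map_det,
        det_toMatrix_pullbackLift])
  exact ⟨τ, by rwa [algebraMap_smul] at hτ⟩

lemma exists_isFrobenius_withTau_of_conj [IsDomain R] (hF : M.IsFrobenius n F)
    (g : M.Laurent ≃ₗ[R⸨X⸩] M.Laurent)
    (h : ∀ x, g (laurentExtend F x) = laurentExtend G (g x)) :
    ∃ τ, (M.withTau τ).IsFrobenius n G := by
  classical
  let b := Module.Free.chooseBasis R⟦X⟧ M.carrier
  refine exists_isFrobenius_withTau b ?_ n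
  exact ((associated_det_of_conj b g h).map (algebraMap R⟦X⟧ (AwayZeta ζ))).isUnit
    (isUnit_det_of_isFrobenius hF b)

end LocalShtuka

namespace LocSht

section StableLattice

variable {Fv R M O : Type*} [Field Fv] [Fintype Fv] [CommRing R] [IsDomain R]
  [Algebra Fv R] [AddCommGroup M] [Module R⟦X⟧ M]

instance [IsPrincipalIdealRing R] :
    IsPrincipalIdealRing (R⟦X⟧ ⧸ Ideal.span {(PowerSeries.X : R⟦X⟧)}) := by
  refine .of_surjective ((Ideal.Quotient.mk (Ideal.span {(PowerSeries.X : R⟦X⟧)})).comp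
    PowerSeries.C) fun y => ?_
  obtain ⟨s, rfl⟩ := Ideal.Quotient.mk_surjective y
  refine ⟨PowerSeries.constantCoeff s, Ideal.Quotient.eq.2 ?_⟩
  simp [Ideal.mem_span_singleton, PowerSeries.X_dvd_iff]

variable (Fv R) in
lemma primeCompl_span_X_le_comap_sigmaHat [(Ideal.span {(PowerSeries.X : R⟦X⟧)}).IsPrime] :
    (Ideal.span {(PowerSeries.X : R⟦X⟧)}).primeCompl ≤
      (Ideal.span {(PowerSeries.X : R⟦X⟧)}).primeCompl.comap (sigmaHat Fv R) := fun s => by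
  simp only [Submonoid.mem_comap, Ideal.mem_primeCompl_iff, Ideal.mem_span_singleton,
    PowerSeries.X_dvd_iff, ← PowerSeries.coeff_zero_eq_constantCoeff_apply, sigmaHat,
    PowerSeries.coeff_map]
  exact (pow_ne_zero _ ·)

lemma exists_conj_laurentExtend [IsPrincipalIdealRing R] [Module.Free R⟦X⟧ M]
    [Module.Finite R⟦X⟧ M] [Semiring O] [Module Fv⟦X⟧ O] [Module.Finite Fv⟦X⟧ O]
    (ρ : O →+* Module.End R⸨X⸩ (R⸨X⸩ ⊗[R⟦X⟧] M))
    (hρ : ∀ c a, ρ (c • a) = algebraMap R⟦X⟧ R⸨X⸩ (constPower Fv R c) • ρ a)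
    (F : M →ₛₗ[sigmaHat Fv R] M)
    (hF : ∀ a x, ρ a (laurentExtend F x) = laurentExtend F (ρ a x)) :
    ∃ (g : (R⸨X⸩ ⊗[R⟦X⟧] M) ≃ₗ[R⸨X⸩] R⸨X⸩ ⊗[R⟦X⟧] M) (G : M →ₛₗ[sigmaHat Fv R] M),
      (∀ x, g (laurentExtend F x) = laurentExtend G (g x)) ∧
      ∀ a m, g (ρ a (g.symm (1 ⊗ₜ m))) ∈ LinearMap.range (TensorProduct.mk R⟦X⟧ R⸨X⸩ M 1) := by
  have := PowerSeries.span_X_isPrime (R := R)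
  obtain ⟨g, hgρ, hgF⟩ := exists_linearEquiv_conj_mem_range ρ hρ
    (restrictLaurent (laurentExtend F)) (fun a x => (hF a x).symm) (PowerSeries.X : R⟦X⟧)
    (IsAdicComplete.le_jacobson_bot _ (Ideal.mem_span_singleton_self _))
    (mem_nonZeroDivisors_of_ne_zero PowerSeries.X_ne_zero)
    (primeCompl_span_X_le_comap_sigmaHat Fv R) (TensorProduct.mk R⟦X⟧ R⸨X⸩ M 1) (by
      rintro _ ⟨m, rfl⟩
      exact ⟨F m, (laurentExtend_one_tmul F m).symm⟩)
  obtain ⟨G, hG⟩ := exists_laurentExtend_eq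
    (g.toLinearMap.comp ((laurentExtend F).comp g.symm.toLinearMap)) fun m => hgF _ ⟨m, rfl⟩
  exact ⟨g, G, fun x => by simp [hG], fun a m => hgρ a _ ⟨m, rfl⟩⟩

end StableLattice

end LocSht

namespace LocalShtuka

open LocSht

variable {Fv : Type u} {R : Type v} [Field Fv] [Fintype Fv] [CommRing R] [Algebra Fv R] {ζ : R}

lemma coe_smul_qEnd (M : LocalShtuka Fv ζ) {E : Type*} [CommRing E] [Algebra Fv⸨X⸩ E]
    [Algebra Fv⟦X⟧ E] [IsScalarTower Fv⟦X⟧ Fv⸨X⸩ E] (ι : E →ₐ[Fv⸨X⸩] M.QEnd) (c : Fv⟦X⟧) (x : E) :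
    (ι (c • x) : Module.End R⸨X⸩ M.Laurent) =
      algebraMap R⟦X⟧ R⸨X⸩ (constPower Fv R c) • (ι x : Module.End R⸨X⸩ M.Laurent) := by
  rw [← algebraMap_smul Fv⸨X⸩, map_smul, Algebra.smul_def]
  have h : constLaurent Fv R (algebraMap Fv⟦X⟧ Fv⸨X⸩ c) =
    algebraMap R⟦X⟧ R⸨X⸩ (constPower Fv R c) := laurentMap_algebraMap _ _
  rw [← h, Algebra.smul_def]
  rfl

lemma exists_algHom_baseChange_eq {N : LocalShtuka Fv ζ} {n : ℕ}
    {G : N.carrier →ₛₗ[sigmaHat Fv R] N.carrier} (hG : N.IsFrobenius n G) {O : Type*} [Semiring O]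
    [Algebra Fv⟦X⟧ O] (ρ : O →+* Module.End R⸨X⸩ N.Laurent)
    (hρ : ∀ c a, ρ (c • a) = algebraMap R⟦X⟧ R⸨X⸩ (constPower Fv R c) • ρ a)
    (hρG : ∀ a x, ρ a (laurentExtend G x) = laurentExtend G (ρ a x))
    (hρN : ∀ a m, ρ a (1 ⊗ₜ m) ∈ LinearMap.range (TensorProduct.mk R⟦X⟧ R⸨X⸩ N.carrier 1)) :
    ∃ j : O →ₐ[Fv⟦X⟧] N.End, ∀ a, (j a : Module.End R⟦X⟧ N.carrier).baseChange R⸨X⸩ = ρ a := by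
  have hinj : Function.Injective (TensorProduct.mk R⟦X⟧ R⸨X⸩ N.carrier 1) :=
    mk_one_laurent_injective
  choose j hj using fun a => exists_semilinearMap_comp_eq hinj
    ((ρ a).restrictScalars R⟦X⟧ ∘ₗ TensorProduct.mk R⟦X⟧ R⸨X⸩ N.carrier 1) (hρN a)
  have hjρ a m : ρ a (1 ⊗ₜ m) = 1 ⊗ₜ j a m := (hj a m).symm
  have hmem a : j a ∈ N.End := isMorphism_of_isFrobenius hG hG fun m => hinj <| by
    simp [← hjρ, ← laurentExtend_one_tmul, hρG]
  refine ⟨.ofLinearMap ⟨⟨fun a => ⟨j a, hmem a⟩, fun a b => ?_⟩, fun c a => ?_⟩ ?_ fun a b => ?_,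
    fun a => semilinearMap_baseChange_ext fun m => (hjρ a m).symm⟩
  all_goals
    refine Subtype.ext (LinearMap.ext fun m => hinj ?_)
  · simp [← hjρ, TensorProduct.tmul_add]
  · rw [TensorProduct.mk_apply, ← hjρ, hρ, LinearMap.smul_apply, hjρ, algebraMap_smul,
      RingHom.id_apply, Algebra.smul_def]
    exact (TensorProduct.tmul_smul _ _ _).symm
  · simp [← hjρ]
  · simp [← hjρ]

end LocalShtuka

end

open LocSht LocalShtuka in
theorem proposition3p2_general
    {Fv : Type u} [Field Fv] [Fintype Fv]
    {R : Type v} [CommRing R] [IsDomain R] [IsPrincipalIdealRing R] [Algebra Fv R] {ζ : R}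
    (M : LocalShtuka.{u, v, w} Fv ζ)
    {E : Type*} [CommRing E] [IsSemisimpleRing E] [Algebra Fv⸨X⸩ E] [Module.Finite Fv⸨X⸩ E]
    [Algebra Fv⟦X⟧ E] [IsScalarTower Fv⟦X⟧ Fv⸨X⸩ E]
    (ι : E →ₐ[Fv⸨X⸩] M.QEnd) (hι : Function.Injective ι) :
    ∃ (M' : LocalShtuka.{u, v, w} Fv ζ) (f : LocalShtuka.QuasiIsogeny M M')
      (j : integralClosure Fv⟦X⟧ E →ₐ[Fv⟦X⟧] M'.End),
      Function.Injective j ∧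
      ∀ a : integralClosure Fv⟦X⟧ E,
        LinearMap.baseChange R⸨X⸩ (j a : Module.End R⟦X⟧ M'.carrier) ∘ₗ
            (f.toLinearEquiv : M.Laurent →ₗ[R⸨X⸩] M'.Laurent) =
          (f.toLinearEquiv : M.Laurent →ₗ[R⸨X⸩] M'.Laurent) ∘ₗ
            (ι (a : E) : Module.End R⸨X⸩ M.Laurent) := by
  have := finite_integralClosure Fv⟦X⟧ Fv⸨X⸩ E
  obtain ⟨n, F, hF⟩ := M.exists_isFrobenius
  let ρ : integralClosure Fv⟦X⟧ E →+* Module.End R⸨X⸩ M.Laurent :=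
    M.QEnd.subtype.comp ((ι : E →+* M.QEnd).comp (integralClosure Fv⟦X⟧ E).subtype)
  have hρ c a : ρ (c • a) = algebraMap R⟦X⟧ R⸨X⸩ (constPower Fv R c) • ρ a :=
    coe_smul_qEnd M ι c a
  have hρF a : ∀ x, ρ a (laurentExtend F x) = laurentExtend F (ρ a x) :=
    (isQuasiMorphism_iff hF hF _).1 (ι a).2
  obtain ⟨g, G, hg, hgρ⟩ := exists_conj_laurentExtend ρ hρ F hρF
  obtain ⟨τ, hG⟩ := exists_isFrobenius_withTau_of_conj hF g hg
  let ρ' : integralClosure Fv⟦X⟧ E →+* Module.End R⸨X⸩ M.Laurent :=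
    (g.conjRingEquiv : _ →+* _).comp ρ
  have hρ'_apply a x : ρ' a x = g (ρ a (g.symm x)) := rfl
  have hρ' c a : ρ' (c • a) = algebraMap R⟦X⟧ R⸨X⸩ (constPower Fv R c) • ρ' a := by
    ext; simp [hρ'_apply, hρ]
  have hρ'G a x : ρ' a (laurentExtend G x) = laurentExtend G (ρ' a x) := by
    obtain ⟨x, rfl⟩ := g.surjective x
    simp [hρ'_apply, ← hg, hρF]
  obtain ⟨j, hj⟩ := exists_algHom_baseChange_eq hG ρ' hρ' hρ'G hgρ
  refine ⟨M.withTau τ, ⟨g, (isQuasiMorphism_iff hF hG _).2 hg⟩, j, fun a b h => ?_, fun a => ?_⟩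
  · have hab : ρ a = ρ b := g.conjRingEquiv.injective ((hj a).symm.trans (h ▸ hj b))
    exact Subtype.ext (hι (Subtype.ext hab))
  · rw [hj]
    exact LinearMap.ext fun x => congrArg (g ∘ ρ a) (g.symm_apply_apply x)

theorem proposition3p2
    {Fv : Type u} [Field Fv] [Fintype Fv]
    {R : Type v} [CommRing R] [IsDomain R] [IsDiscreteValuationRing R]
    [IsAdicComplete (IsLocalRing.maximalIdeal R) R] [Finite (IsLocalRing.ResidueField R)]
    [Algebra Fv R] (γ : Fv⟦X⟧ →ₐ[Fv] R) (hγ : Function.Injective γ)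
    (hζ : γ PowerSeries.X ∈ IsLocalRing.maximalIdeal R)
    (M : LocalShtuka.{u, v, w} Fv (γ PowerSeries.X))
    {E : Type*} [CommRing E] [Algebra Fv⸨X⸩ E]
    [Algebra Fv⟦X⟧ E] [IsScalarTower Fv⟦X⟧ Fv⸨X⸩ E]
    (ι : E →ₐ[Fv⸨X⸩] M.QEnd) (hCM : M.IsCM ι) :
    ∃ (M' : LocalShtuka.{u, v, w} Fv (γ PowerSeries.X)) (f : LocalShtuka.QuasiIsogeny M M')
      (j : integralClosure Fv⟦X⟧ E →ₐ[Fv⟦X⟧] M'.End),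
      Function.Injective j ∧
      ∀ a : integralClosure Fv⟦X⟧ E,
        LinearMap.baseChange R⸨X⸩ (j a : Module.End R⟦X⟧ M'.carrier) ∘ₗ (f.toLinearEquiv : M.Laurent →ₗ[R⸨X⸩] M'.Laurent) =
          (f.toLinearEquiv : M.Laurent →ₗ[R⸨X⸩] M'.Laurent) ∘ₗ
            (ι (a : E) : Module.End R⸨X⸩ M.Laurent) := by
  have := hCM.isSemisimpleRing
  have := hCM.finite
  exact proposition3p2_general M ι hCM.injective
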